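/- \textbf{Setting.} Let $S$ and $A$ be Polish spaces with their Borel $\sigma$-fields, $A$ compact. Let $P$ be a stochastic kernel from $S\times A$ to $S$, let $c:S\times A\to\mathbb R$ be measurable with $|c|\le 1$, let $\gamma\in[0,1)$, $\tau>0$, let $\mu$ be a probability measure on $A$ with full support, and let $\rho$ be a probability measure on $S$. Let $g=(g_1,\dots,g_p):S\times A\to\mathbb R^p$ be measurable with $\sum_{i=1}^p \sup_{S\times A}|g_i|^2\le 1$. For $\theta\in\mathbb R^p$ define the policy \[ \pi_\theta(da\mid s)=\frac{d\pi_\theta}{d\mu}(a\mid s)\,\mu(da),\qquad \frac{d\pi_\theta}{d\mu}(a\mid s)=\frac{e^{\langle\theta,g(s,a)\rangle}}{\int_A e^{\langle\theta,g(s,a')\rangle}\mu(da')}, \] and the entropy-regularized value function \[ V_\tau^{\pi_\theta}(\rho)=\mathbb E\Big[\sum_{n=0}^\infty\gamma^n\Big(c(s_n,a_n)+\tau\log\tfrac{d\pi_\theta}{d\mu}(a_n\mid s_n)\Big)\Big], \] where $s_0\sim\rho$, $a_n\sim\pi_\theta(\cdot\mid s_n)$ and $s_{n+1}\sim P(\cdot\mid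 s_n,a_n)$. \textbf{Lemma} (Existence of solution to the gradient flow using full affine span features). Assume that for every $s\in S$ the map $a\mapsto g(s,a)$ is continuous and that for every $u\in\mathbb R^p$ with $\|u\|_2=1$ \[ \mu\Big(\operatorname*{arg\,max}_{a\in A}\,\langle u,g(s,a)\rangle\Big)=0 . \] Then for every $\theta_0\in\mathbb R^p$ there exists a solution $\{\theta_t\}_{t\ge0}$, defined for all $t\ge 0$ and started at $\theta_0$, of the policy gradient flow \[ \frac{d}{dt}\theta_t=-\nabla_\theta V_\tau^{\pi_\theta}(\rho)\big|_{\theta=\theta_t},\qquad t\ge0 \] (in particular $\theta\mapsto V_\tau^{\pi_\theta}(\rho)$ is differentiable at every $\theta_t$), and along it \[ \sup_{t\ge0}\ \sup_{(s,a)\in S\times A}\Big|\log\tfrac{d\pi_{\theta_t}}{d\mu}(a\mid s)\Big|<\infty . \] -/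

import Mathlib

open MeasureTheory ProbabilityTheory
open scoped ENNReal

noncomputable section

namespace EntropyMDP

/-- The supremum norm `|f| = sup_x |f x|`, as an extended nonnegative real (`∞` if `f` is
unbounded). -/
def supNorm {X : Type*} (f : X → ℝ) : ℝ≥0∞ := ⨆ x, ‖f x‖ₑ

/-- A `γ`-discounted infinite horizon `τ`-entropy regularized Markov decision model
`(S, A, P, c, γ, τ, μ)`: transition kernel `P`, measurable cost `c` with `|c| ≤ 1`, discount factor
`γ ∈ [0, 1)`, temperature `τ > 0`, and a reference probability measure `μ` of full support. -/
structure Model (S A : Type*) [MeasurableSpace S] [MeasurableSpace A] [TopologicalSpace A] where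
  P : Kernel (S × A) S
  markov_P : IsMarkovKernel P
  c : S × A → ℝ
  measurable_c : Measurable c
  supNorm_c_le : supNorm c ≤ 1
  γ : ℝ
  γ_nonneg : 0 ≤ γ
  γ_lt_one : γ < 1
  τ : ℝ
  τ_pos : 0 < τ
  μ : Measure A
  prob_μ : IsProbabilityMeasure μ
  fullSupport_μ : μ.IsOpenPosMeasure

attribute [instance] Model.markov_P Model.prob_μ Model.fullSupport_μ

/-- A feature basis `g : S × A → ℝ^p`: measurable, with `∑ i, |g_i|² ≤ 1` for the supremum norms of
its components. -/
structure Features (S A : Type*) [MeasurableSpace S] [MeasurableSpace A] (p : ℕ) where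
  g : S × A → EuclideanSpace ℝ (Fin p)
  measurable_g : Measurable g
  sum_supNorm_sq_le : ∑ i, supNorm (fun x => g x i) ^ 2 ≤ 1

section

variable {S A : Type*} [MeasurableSpace S] [MeasurableSpace A] {p : ℕ}

theorem Features.norm_le_one (φ : Features S A p) (x : S × A) : ‖φ.g x‖ ≤ 1 := by
  have h1 : ∑ i, ‖φ.g x i‖ₑ ^ 2 ≤ 1 := by
    refine le_trans (Finset.sum_le_sum fun i _ => ?_) φ.sum_supNorm_sq_le
    gcongr
    exact le_iSup (fun y => ‖φ.g y i‖ₑ) x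
  have h2 : ∑ i, ‖φ.g x i‖ ^ 2 ≤ 1 := by
    have h3 : ENNReal.ofReal (∑ i, ‖φ.g x i‖ ^ 2) ≤ 1 := by
      rw [ENNReal.ofReal_sum_of_nonneg fun i _ => by positivity]
      refine le_trans (le_of_eq (Finset.sum_congr rfl fun i _ => ?_)) h1
      rw [ENNReal.ofReal_pow (norm_nonneg _), ofReal_norm]
    simpa using h3
  rw [← EuclideanSpace.norm_sq_eq] at h2
  nlinarith [norm_nonneg (φ.g x)]

/-- The energy `⟨θ, g(s, a)⟩`. -/
def Features.energy (φ : Features S A p) (θ : EuclideanSpace ℝ (Fin p)) (x : S × A) : ℝ :=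
  inner ℝ θ (φ.g x)

theorem Features.measurable_energy (φ : Features S A p) (θ : EuclideanSpace ℝ (Fin p)) :
    Measurable (φ.energy θ) :=
  Measurable.inner measurable_const φ.measurable_g

theorem Features.abs_energy_le (φ : Features S A p) (θ : EuclideanSpace ℝ (Fin p)) (x : S × A) :
    |φ.energy θ x| ≤ ‖θ‖ := by
  refine (abs_real_inner_le_norm _ _).trans ?_
  simpa using mul_le_mul_of_nonneg_left (φ.norm_le_one x) (norm_nonneg θ)

variable [TopologicalSpace A]

theorem Features.integrable_exp_energy (φ : Features S A p) (M : Model S A)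
    (θ : EuclideanSpace ℝ (Fin p)) (s : S) :
    Integrable (fun a => Real.exp (φ.energy θ (s, a))) M.μ := by
  refine Integrable.of_bound (C := Real.exp ‖θ‖)
    ((φ.measurable_energy θ).comp measurable_prodMk_left).exp.aestronglyMeasurable ?_
  filter_upwards with a
  rw [Real.norm_eq_abs, Real.abs_exp]
  exact Real.exp_le_exp.2 (le_of_abs_le (φ.abs_energy_le θ (s, a)))

namespace Model

/-- The normalising constant `Z_θ(s) = ∫ exp ⟨θ, g(s, a)⟩ μ(da)`. -/
def partition (M : Model S A) (φ : Features S A p) (θ : EuclideanSpace ℝ (Fin p)) (s : S) : ℝ :=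
  ∫ a, Real.exp (φ.energy θ (s, a)) ∂M.μ

/-- The density `dπ_θ/dμ (a|s) = exp ⟨θ, g(s, a)⟩ / Z_θ(s)`, defined at every `(s, a)`. -/
def density (M : Model S A) (φ : Features S A p) (θ : EuclideanSpace ℝ (Fin p)) (x : S × A) : ℝ :=
  Real.exp (φ.energy θ x) / M.partition φ θ x.1

/-- The log-density `log dπ_θ/dμ (a|s)`. -/
def logDensity (M : Model S A) (φ : Features S A p) (θ : EuclideanSpace ℝ (Fin p))
    (x : S × A) : ℝ :=
  Real.log (M.density φ θ x)

theorem measurable_density (M : Model S A) (φ : Features S A p)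
    (θ : EuclideanSpace ℝ (Fin p)) : Measurable (M.density φ θ) := by
  have h : StronglyMeasurable (M.partition φ θ) :=
    StronglyMeasurable.integral_prod_right' (ν := M.μ)
      (f := fun x : S × A => Real.exp (φ.energy θ x))
      (φ.measurable_energy θ).exp.stronglyMeasurable
  exact (φ.measurable_energy θ).exp.div (h.measurable.comp measurable_fst)

/-- The log-linear softmax policy
`π_θ(da|s) = exp ⟨θ, g(s, a)⟩ μ(da) / ∫ exp ⟨θ, g(s, a')⟩ μ(da')`. -/
def policy (M : Model S A) (φ : Features S A p) (θ : EuclideanSpace ℝ (Fin p)) : Kernel S A :=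
  (Kernel.const S M.μ).withDensity fun s a => ENNReal.ofReal (M.density φ θ (s, a))

theorem policy_apply (M : Model S A) (φ : Features S A p) (θ : EuclideanSpace ℝ (Fin p)) (s : S) :
    M.policy φ θ s = M.μ.withDensity fun a => ENNReal.ofReal (M.density φ θ (s, a)) := by
  rw [policy, Kernel.withDensity_apply, Kernel.const_apply]
  exact (M.measurable_density φ θ).ennreal_ofReal

instance (M : Model S A) (φ : Features S A p) (θ : EuclideanSpace ℝ (Fin p)) :
    IsMarkovKernel (M.policy φ θ) := by
  refine ⟨fun s => ?_⟩
  rw [policy_apply]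
  exact isProbabilityMeasure_tilted (φ.integrable_exp_energy M θ s)

/-- `M.density φ θ (s, ·)` is a version of the Radon-Nikodym derivative of `π_θ(·|s)`. -/
theorem rnDeriv_policy (M : Model S A) (φ : Features S A p) (θ : EuclideanSpace ℝ (Fin p)) (s : S) :
    (M.policy φ θ s).rnDeriv M.μ =ᵐ[M.μ] fun a => ENNReal.ofReal (M.density φ θ (s, a)) := by
  rw [policy_apply]
  exact Measure.rnDeriv_withDensity _
    ((M.measurable_density φ θ).comp measurable_prodMk_left).ennreal_ofReal

/-- One step of the controlled process: given the history `(s_0, a_0), …, (s_n, a_n)`, draw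
`s_{n+1} ∼ P(·|s_n, a_n)` and then `a_{n+1} ∼ π(·|s_{n+1})`. -/
def step (M : Model S A) (π : Kernel S A) (n : ℕ) :
    Kernel (Finset.Iic n → S × A) (S × A) :=
  (M.P ⊗ₖ Kernel.prodMkLeft (S × A) π).comap
    (fun h => h ⟨n, Finset.mem_Iic.2 le_rfl⟩) (measurable_pi_apply _)

instance (M : Model S A) (π : Kernel S A) [IsMarkovKernel π] (n : ℕ) :
    IsMarkovKernel (M.step π n) := by
  unfold step
  infer_instance

/-- The law on `(S × A)^ℕ` of the trajectory `((s_n, a_n))_n` with `s_0 ∼ ρ`, `a_n ∼ π(·|s_n)` and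
`s_{n+1} ∼ P(·|s_n, a_n)`. -/
def trajectoryLaw (M : Model S A) (ρ : Measure S) (π : Kernel S A) [IsMarkovKernel π] :
    Measure (ℕ → S × A) :=
  Kernel.trajMeasure (X := fun _ => S × A) (ρ ⊗ₘ π) (M.step π)

/-- The entropy regularized value function of the policy `π_θ` started from `ρ`:
`V(ρ) = E [∑ n, γ^n (c(s_n, a_n) + τ log dπ_θ/dμ (a_n|s_n))]`. -/
def value (M : Model S A) (φ : Features S A p) (ρ : Measure S)
    (θ : EuclideanSpace ℝ (Fin p)) : ℝ :=
  ∫ ω, ∑' n : ℕ, M.γ ^ n * (M.c (ω n) + M.τ * M.logDensity φ θ (ω n))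
    ∂(M.trajectoryLaw ρ (M.policy φ θ))

/-- For each state `s` the map `a ↦ g(s, a)` is continuous and, for every unit vector `u`, the set
of maximizers of `a ↦ ⟨u, g(s, a)⟩` is `μ`-null. -/
def MaxSetNull (M : Model S A) (φ : Features S A p) : Prop :=
  ∀ s : S, Continuous (fun a => φ.g (s, a)) ∧
    ∀ u : EuclideanSpace ℝ (Fin p), ‖u‖ = 1 →
      M.μ {a | ∀ b, inner ℝ u (φ.g (s, b)) ≤ inner ℝ u (φ.g (s, a))} = 0

end Model

end

/-- `θ : [0, ∞) → ℝ^p` solves `dθ_t/dt = -∇F(θ_t)` with initial value `θ₀`; in particular `F` is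
differentiable at every `θ_t` (values at negative times play no role, and the derivative at `t = 0`
is one-sided). -/
def IsGradientFlow {p : ℕ} (F : EuclideanSpace ℝ (Fin p) → ℝ) (θ₀ : EuclideanSpace ℝ (Fin p))
    (θ : ℝ → EuclideanSpace ℝ (Fin p)) : Prop :=
  θ 0 = θ₀ ∧ ∀ t : ℝ, 0 ≤ t → ∃ v : EuclideanSpace ℝ (Fin p),
    HasGradientAt F v (θ t) ∧ HasDerivWithinAt θ (-v) (Set.Ici 0) t

end EntropyMDP

end

/-!
The value `V` is a smooth function of `θ` with bounded sublevel sets; along a gradient flow `V`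
decreases, so the flow stays in a ball, exists for all times, and the log-densities, which satisfy
`|log dπ_θ/dμ| ≤ 2 ‖θ‖`, stay bounded.

*Smoothness* (`EntropyMDP.Model.contDiff_value`). Bounded measurable functions on `S` and on `S × A`
form Banach algebras for the supremum norm. In them `exp ⟨θ, g⟩` is the exponential of a linear map,
and `log Z_θ` is smooth by the inverse function theorem for `exp`
(`EntropyMDP.BoundedMeasurable.contDiff_of_exp_eq`). Hence the averaging operator of the policy
`π_θ` and the regularized cost depend smoothly on `θ`, in operator norm and in supremum norm. By
the Markov property of the trajectory, `V(θ) = ⟨ρ, (1 - γ K_θ)⁻¹ r_θ⟩`, where `K_θ` is the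
transition operator of the state and `r_θ` the averaged cost
(`EntropyMDP.Model.value_eq_resolvent`), and inversion is smooth on the units of a Banach algebra.

*Coercivity* (`EntropyMDP.Model.exists_norm_le_of_value_le`). Up to an additive constant, `V(θ)` is
at least `τ ∫ KL(π_θ(·|s) | μ) ρ(ds)`. If `‖θ_k‖ → ∞` with `θ_k / ‖θ_k‖ → u`, then
`π_{θ_k}(·|s)` concentrates on each superlevel set `{a | max ⟨u, g(s, ·)⟩ - ε ≤ ⟨u, g(s, a)⟩}`,
`ε > 0`. These sets decrease to the `μ`-null set of maximizers, hence have arbitrarily small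
`μ`-measure, and the entropy inequality forces the relative entropy to infinity for every `s`;
Fatou's lemma passes this to the integral over `s`.

*Flow* (`EntropyMDP.exists_isGradientFlow`). Cutting the gradient off outside a large ball gives a
bounded Lipschitz field, which has a global integral curve; since `V` decreases along it, the curve
never meets the cut-off.
-/

noncomputable section

namespace EntropyMDP

/-! ### The Banach algebra of bounded measurable functions -/

section BoundedMeasurable

variable (X : Type*) [MeasurableSpace X]

/-- The functions in `ℓ^∞(X)` that are measurable, as a subalgebra. -/
def measurableSubalgebra : Subalgebra ℝ (lp (fun _ : X => ℝ) ∞) where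
  carrier := {f | Measurable (f : X → ℝ)}
  mul_mem' {f g} hf hg := by
    simp only [Set.mem_ofPred_eq, lp.infty_coeFn_mul] at *
    exact hf.mul hg
  add_mem' {f g} hf hg := by
    simp only [Set.mem_ofPred_eq, lp.coeFn_add] at *
    exact hf.add hg
  algebraMap_mem' r := (measurable_const : Measurable fun _ : X => r)

/-- The Banach algebra of bounded measurable functions `X → ℝ` under the supremum norm; functions
that agree almost everywhere are not identified. -/
def BoundedMeasurable : Type _ := measurableSubalgebra X

variable {X}

namespace BoundedMeasurable

instance : NormedCommRing (BoundedMeasurable X) :=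
  inferInstanceAs (NormedCommRing (measurableSubalgebra X))

instance : NormedAlgebra ℝ (BoundedMeasurable X) :=
  inferInstanceAs (NormedAlgebra ℝ (measurableSubalgebra X))

instance : FunLike (BoundedMeasurable X) X ℝ where
  coe f := f.1.1
  coe_injective _ _ h := Subtype.ext (Subtype.ext h)

theorem measurable (f : BoundedMeasurable X) : Measurable (f : X → ℝ) := f.2

@[ext]
theorem ext {f g : BoundedMeasurable X} (h : ∀ x, f x = g x) : f = g :=
  DFunLike.ext _ _ h

theorem abs_apply_le_norm (f : BoundedMeasurable X) (x : X) : |f x| ≤ ‖f‖ :=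
  lp.norm_apply_le_norm (by simp) f.1 x

theorem norm_le {f : BoundedMeasurable X} {C : ℝ} (hC : 0 ≤ C) (h : ∀ x, |f x| ≤ C) : ‖f‖ ≤ C :=
  lp.norm_le_of_forall_le (f := f.1) hC h

/-- The bounded measurable function with given values. -/
def mk (f : X → ℝ) (hf : Measurable f) (C : ℝ) (hC : ∀ x, |f x| ≤ C) : BoundedMeasurable X :=
  ⟨⟨f, memℓp_infty ⟨C, by rintro _ ⟨x, rfl⟩; exact hC x⟩⟩, hf⟩

/-- Evaluation at a point, as an algebra homomorphism. -/
def eval (x : X) : BoundedMeasurable X →ₐ[ℝ] ℝ where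
  toFun f := f x
  map_one' := rfl
  map_mul' _ _ := rfl
  map_zero' := rfl
  map_add' _ _ := rfl
  commutes' _ := rfl

@[simp]
theorem mul_apply (f g : BoundedMeasurable X) (x : X) : (f * g) x = f x * g x := rfl

@[simp]
theorem add_apply (f g : BoundedMeasurable X) (x : X) : (f + g) x = f x + g x := rfl

@[simp]
theorem sub_apply (f g : BoundedMeasurable X) (x : X) : (f - g) x = f x - g x := rfl

@[simp]
theorem smul_apply (r : ℝ) (f : BoundedMeasurable X) (x : X) : (r • f) x = r * f x := rfl

theorem continuous_eval (x : X) : Continuous (eval x) :=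
  AddMonoidHomClass.continuous_of_bound (eval x) 1 fun f => by
    rw [one_mul]
    exact abs_apply_le_norm f x

theorem isClosed_measurableSubalgebra :
    IsClosed (measurableSubalgebra X : Set (lp (fun _ : X => ℝ) ∞)) := by
  refine IsSeqClosed.isClosed fun u f hu hf => ?_
  refine measurable_of_tendsto_metrizable hu ?_
  refine tendsto_pi_nhds.2 fun x => ?_
  exact ((lp.evalCLM ℝ (fun _ : X => ℝ) ∞ x).continuous.tendsto f).comp hf

instance : CompleteSpace (BoundedMeasurable X) :=
  (isClosed_measurableSubalgebra (X := X)).completeSpace_coe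

theorem exp_apply (f : BoundedMeasurable X) (x : X) :
    (NormedSpace.exp f : BoundedMeasurable X) x = Real.exp (f x) := by
  let _ : NormedAlgebra ℚ (BoundedMeasurable X) := NormedAlgebra.restrictScalars ℚ ℝ _
  rw [Real.exp_eq_exp_ℝ]
  exact NormedSpace.map_exp (eval x) (continuous_eval x) f

theorem exp_injective : Function.Injective (NormedSpace.exp : BoundedMeasurable X → _) := by
  intro f g h
  ext x
  have := congrArg (fun k : BoundedMeasurable X => k x) h
  simpa only [exp_apply, Real.exp_eq_exp] using this

theorem integrable (f : BoundedMeasurable X) (ν : Measure X) [IsFiniteMeasure ν] :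
    Integrable (f : X → ℝ) ν :=
  Integrable.of_bound f.measurable.aestronglyMeasurable ‖f‖
    (Filter.Eventually.of_forall fun x => f.abs_apply_le_norm x)

theorem contDiff_exp {n : WithTop ℕ∞} :
    ContDiff ℝ n (NormedSpace.exp : BoundedMeasurable X → BoundedMeasurable X) :=
  contDiff_iff_contDiffAt.2 fun f => (NormedSpace.exp_analytic (𝕂 := ℝ) f).contDiffAt

/-- A logarithm of a `C^n` family is `C^n`: the derivative of `exp` at any point is multiplication
by a unit, so the logarithm is locally the inverse given by the inverse function theorem. -/
theorem contDiff_of_exp_eq {E : Type*} [NormedAddCommGroup E] [NormedSpace ℝ E]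
    {n : WithTop ℕ∞} (hn : n ≠ 0) {f l : E → BoundedMeasurable X} (hf : ContDiff ℝ n f)
    (hl : ∀ e, NormedSpace.exp (l e) = f e) : ContDiff ℝ n l := by
  refine contDiff_iff_contDiffAt.2 fun e => ?_
  let u : BoundedMeasurable X →L[ℝ] BoundedMeasurable X :=
    ContinuousLinearMap.mul ℝ _ (NormedSpace.exp (l e))
  let v : BoundedMeasurable X →L[ℝ] BoundedMeasurable X :=
    ContinuousLinearMap.mul ℝ _ (NormedSpace.exp (-l e))
  have hexp : ∀ x, Real.exp ((l e) x) * Real.exp ((-l e) x) = 1 := fun x => by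
    rw [← Real.exp_add]
    have : (-l e) x = -(l e x) := rfl
    rw [this, add_neg_cancel, Real.exp_zero]
  let w : BoundedMeasurable X ≃L[ℝ] BoundedMeasurable X :=
    ContinuousLinearEquiv.equivOfInverse u v
      (fun k => by
        ext x
        simp only [u, v, ContinuousLinearMap.mul_apply', mul_apply, exp_apply]
        rw [← mul_assoc, mul_comm (Real.exp _) (Real.exp _), hexp, one_mul])
      (fun k => by
        ext x
        simp only [u, v, ContinuousLinearMap.mul_apply', mul_apply, exp_apply]
        rw [← mul_assoc, hexp, one_mul])
  have hd : HasFDerivAt (NormedSpace.exp : BoundedMeasurable X → _)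
      (w : BoundedMeasurable X →L[ℝ] BoundedMeasurable X) (l e) := by
    refine (hasFDerivAt_exp (𝕂 := ℝ) (x := l e)).congr_fderiv ?_
    ext k : 1
    rfl
  have hc : ContDiffAt ℝ n (NormedSpace.exp : BoundedMeasurable X → _) (l e) :=
    contDiff_exp.contDiffAt
  have hs := hc.hasStrictFDerivAt' hd hn
  have hi : ContDiffAt ℝ n (hc.localInverse hd hn) (f e) := by
    rw [← hl e]
    exact hc.to_localInverse hd hn
  refine (hi.comp e hf.contDiffAt).congr_of_eventuallyEq ?_
  have hr : ∀ᶠ y in nhds (f e), NormedSpace.exp (hc.localInverse hd hn y) = y := by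
    rw [← hl e]
    exact hs.eventually_right_inverse
  filter_upwards [hf.continuous.continuousAt.eventually hr] with e' he'
  exact exp_injective ((hl e').trans he'.symm)

end BoundedMeasurable

/-- Integration against a Markov kernel, as an operator on bounded measurable functions. -/
def kernelOp {X Y : Type*} [MeasurableSpace X] [MeasurableSpace Y] (κ : Kernel X Y)
    [IsMarkovKernel κ] : BoundedMeasurable Y →L[ℝ] BoundedMeasurable X :=
  LinearMap.mkContinuous
    { toFun := fun f => BoundedMeasurable.mk (fun x => ∫ y, f y ∂κ x)
        (f.measurable.stronglyMeasurable.integral_kernel).measurable ‖f‖ (fun x => by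
          have := norm_integral_le_of_norm_le_const (μ := κ x) (f := (f : Y → ℝ)) (C := ‖f‖)
            (Filter.Eventually.of_forall fun y => f.abs_apply_le_norm y)
          simpa using! this)
      map_add' := fun f g => by
        ext x
        exact integral_add (f.integrable _) (g.integrable _)
      map_smul' := fun r f => by
        ext x
        exact integral_const_mul _ _ }
    1 (fun f => by
      rw [one_mul]
      refine BoundedMeasurable.norm_le (norm_nonneg _) fun x => ?_
      have := norm_integral_le_of_norm_le_const (μ := κ x) (f := (f : Y → ℝ)) (C := ‖f‖)
        (Filter.Eventually.of_forall fun y => f.abs_apply_le_norm y)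
      simpa using! this)

section kernelOp

variable {Y : Type*} [MeasurableSpace Y] (κ : Kernel X Y) [IsMarkovKernel κ]

theorem kernelOp_apply (f : BoundedMeasurable Y) (x : X) : kernelOp κ f x = ∫ y, f y ∂κ x := rfl

theorem norm_kernelOp_le : ‖kernelOp κ‖ ≤ 1 :=
  LinearMap.mkContinuous_norm_le _ zero_le_one _

theorem le_kernelOp {f : BoundedMeasurable Y} {C : ℝ} (h : ∀ y, C ≤ f y) (x : X) :
    C ≤ kernelOp κ f x := by
  have := integral_mono (μ := κ x) (integrable_const C) (f.integrable _) h
  simpa [kernelOp_apply] using this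

end kernelOp

/-- Integration against a probability measure, as a functional on bounded measurable functions. -/
def integralCLM (ν : Measure X) [IsProbabilityMeasure ν] : BoundedMeasurable X →L[ℝ] ℝ :=
  LinearMap.mkContinuous
    { toFun := fun f => ∫ x, f x ∂ν
      map_add' := fun f g => integral_add (f.integrable _) (g.integrable _)
      map_smul' := fun r f => integral_const_mul _ _ }
    1 (fun f => by
      have := norm_integral_le_of_norm_le_const (μ := ν) (f := (f : X → ℝ)) (C := ‖f‖)
        (Filter.Eventually.of_forall fun y => f.abs_apply_le_norm y)
      simpa using! this)

theorem integralCLM_apply (ν : Measure X) [IsProbabilityMeasure ν] (f : BoundedMeasurable X) :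
    integralCLM ν f = ∫ x, f x ∂ν := rfl

end BoundedMeasurable

/-! ### The Bellman operator and the resolvent formula for the value -/

section Graph

variable {X Y : Type*} [MeasurableSpace X] [MeasurableSpace Y] (κ : Kernel X Y) [IsMarkovKernel κ]

theorem kernelOp_id_prod_apply (f : BoundedMeasurable (X × Y)) (x : X) :
    kernelOp (Kernel.id ×ₖ κ) f x = ∫ y, f (x, y) ∂κ x := by
  rw [kernelOp_apply, Kernel.prod_apply, Kernel.id_apply, Measure.dirac_prod,
    integral_map measurable_prodMk_left.aemeasurable f.measurable.aestronglyMeasurable]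

theorem kernelOp_deterministic_apply {g : X → Y} (hg : Measurable g) (f : BoundedMeasurable Y)
    (x : X) : kernelOp (Kernel.deterministic g hg) f x = f (g x) := by
  rw [kernelOp_apply, Kernel.deterministic_apply,
    integral_dirac' _ _ f.measurable.stronglyMeasurable]

end Graph

variable {S A : Type*} [MeasurableSpace S] [MeasurableSpace A] {p : ℕ}

/-- The energy `θ ↦ ⟨θ, g⟩` as a linear map into the bounded measurable functions. -/
def Features.energyCLM (φ : Features S A p) :
    EuclideanSpace ℝ (Fin p) →L[ℝ] BoundedMeasurable (S × A) :=
  LinearMap.mkContinuous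
    { toFun := fun θ => BoundedMeasurable.mk (φ.energy θ) (φ.measurable_energy θ) ‖θ‖
        (φ.abs_energy_le θ)
      map_add' := fun θ θ' => by
        ext x
        exact inner_add_left θ θ' (φ.g x)
      map_smul' := fun r θ => by
        ext x
        exact real_inner_smul_left θ (φ.g x) r }
    1 (fun θ => by
      rw [one_mul]
      exact BoundedMeasurable.norm_le (norm_nonneg _) (φ.abs_energy_le θ))

namespace Model

variable [TopologicalSpace A] (M : Model S A) (φ : Features S A p)
  (θ : EuclideanSpace ℝ (Fin p))

theorem abs_cost_le_one (x : S × A) : |M.c x| ≤ 1 := by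
  have h : ‖M.c x‖ₑ ≤ 1 := (le_iSup (fun y => ‖M.c y‖ₑ) x).trans M.supNorm_c_le
  rwa [← ofReal_norm, ENNReal.ofReal_le_one] at h

theorem exp_neg_norm_le_partition (s : S) : Real.exp (-‖θ‖) ≤ M.partition φ θ s := by
  have := integral_mono (μ := M.μ) (integrable_const (Real.exp (-‖θ‖)))
    (φ.integrable_exp_energy M θ s) fun a =>
      Real.exp_le_exp.2 (neg_le_of_abs_le (φ.abs_energy_le θ (s, a)))
  simpa [partition] using this

theorem partition_pos (s : S) : 0 < M.partition φ θ s :=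
  (Real.exp_pos _).trans_le (M.exp_neg_norm_le_partition φ θ s)

theorem partition_le_exp_norm (s : S) : M.partition φ θ s ≤ Real.exp ‖θ‖ := by
  have := integral_mono (μ := M.μ) (φ.integrable_exp_energy M θ s)
    (integrable_const (Real.exp ‖θ‖)) fun a =>
      Real.exp_le_exp.2 (le_of_abs_le (φ.abs_energy_le θ (s, a)))
  simpa [partition] using this

theorem abs_log_partition_le (s : S) : |Real.log (M.partition φ θ s)| ≤ ‖θ‖ := by
  have hpos := M.partition_pos φ θ s
  rw [abs_le]
  exact ⟨(Real.le_log_iff_exp_le hpos).2 (M.exp_neg_norm_le_partition φ θ s),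
    (Real.log_le_iff_le_exp hpos).2 (M.partition_le_exp_norm φ θ s)⟩

theorem measurable_partition : Measurable (M.partition φ θ) :=
  (StronglyMeasurable.integral_prod_right' (ν := M.μ)
    (f := fun x : S × A => Real.exp (φ.energy θ x))
    (φ.measurable_energy θ).exp.stronglyMeasurable).measurable

theorem logDensity_eq (x : S × A) :
    M.logDensity φ θ x = φ.energy θ x - Real.log (M.partition φ θ x.1) := by
  rw [logDensity, density, Real.log_div (Real.exp_pos _).ne' (M.partition_pos φ θ x.1).ne',
    Real.log_exp]

theorem density_pos (x : S × A) : 0 < M.density φ θ x :=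
  div_pos (Real.exp_pos _) (M.partition_pos φ θ x.1)

theorem exp_logDensity (x : S × A) : Real.exp (M.logDensity φ θ x) = M.density φ θ x :=
  Real.exp_log (M.density_pos φ θ x)

theorem abs_logDensity_le (x : S × A) : |M.logDensity φ θ x| ≤ 2 * ‖θ‖ := by
  rw [logDensity_eq]
  have h1 := φ.abs_energy_le θ x
  have h2 := M.abs_log_partition_le φ θ x.1
  exact (abs_sub _ _).trans (by linarith)

/-- The log-partition function as a bounded measurable function of the state. -/
def logPartition : BoundedMeasurable S :=
  .mk (fun s => Real.log (M.partition φ θ s)) (M.measurable_partition φ θ).log ‖θ‖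
    (M.abs_log_partition_le φ θ)

/-- The log-density as a bounded measurable function. -/
def logDensityBM : BoundedMeasurable (S × A) :=
  φ.energyCLM θ - kernelOp (Kernel.deterministic Prod.fst measurable_fst) (M.logPartition φ θ)

theorem logDensityBM_apply (x : S × A) : M.logDensityBM φ θ x = M.logDensity φ θ x := by
  rw [logDensityBM, BoundedMeasurable.sub_apply, kernelOp_deterministic_apply, logDensity_eq]
  rfl

theorem exp_logDensityBM_apply (x : S × A) :
    (NormedSpace.exp (M.logDensityBM φ θ) : BoundedMeasurable (S × A)) x = M.density φ θ x := by
  rw [BoundedMeasurable.exp_apply, logDensityBM_apply, exp_logDensity]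

theorem contDiff_logPartition {n : WithTop ℕ∞} (hn : n ≠ 0) :
    ContDiff ℝ n (M.logPartition φ) := by
  refine BoundedMeasurable.contDiff_of_exp_eq hn
    (f := fun θ => kernelOp (Kernel.id ×ₖ Kernel.const S M.μ) (NormedSpace.exp (φ.energyCLM θ)))
    ?_ fun θ => ?_
  · exact (ContinuousLinearMap.contDiff _).comp
      (BoundedMeasurable.contDiff_exp.comp (ContinuousLinearMap.contDiff _))
  · ext s
    rw [BoundedMeasurable.exp_apply, kernelOp_id_prod_apply]
    simp only [BoundedMeasurable.exp_apply]
    exact Real.exp_log (M.partition_pos φ θ s)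

theorem contDiff_logDensityBM {n : WithTop ℕ∞} (hn : n ≠ 0) :
    ContDiff ℝ n (M.logDensityBM φ) :=
  (ContinuousLinearMap.contDiff _).sub
    ((ContinuousLinearMap.contDiff _).comp (M.contDiff_logPartition φ hn))

/-- The action average `(Π f)(s) = ∫ f(s, a) π_θ(da|s)`. -/
def policyOp : BoundedMeasurable (S × A) →L[ℝ] BoundedMeasurable S :=
  kernelOp (Kernel.id ×ₖ M.policy φ θ)

theorem policyOp_apply_eq_integral_density (f : BoundedMeasurable (S × A)) (s : S) :
    M.policyOp φ θ f s = ∫ a, M.density φ θ (s, a) * f (s, a) ∂M.μ := by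
  rw [policyOp, kernelOp_id_prod_apply, policy_apply,
    integral_withDensity_eq_integral_toReal_smul
      (f := fun a => ENNReal.ofReal (M.density φ θ (s, a)))
      ((M.measurable_density φ θ).comp measurable_prodMk_left).ennreal_ofReal
      (Filter.Eventually.of_forall fun _ => ENNReal.ofReal_lt_top)]
  refine integral_congr_ae (Filter.Eventually.of_forall fun a => ?_)
  simp [ENNReal.toReal_ofReal (M.density_pos φ θ (s, a)).le]

theorem policyOp_eq : M.policyOp φ θ = (kernelOp (Kernel.id ×ₖ Kernel.const S M.μ)).comp
    (ContinuousLinearMap.mul ℝ _ (NormedSpace.exp (M.logDensityBM φ θ))) := by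
  ext f s
  rw [policyOp_apply_eq_integral_density, ContinuousLinearMap.comp_apply, kernelOp_id_prod_apply]
  simp only [ContinuousLinearMap.mul_apply', BoundedMeasurable.mul_apply, exp_logDensityBM_apply,
    Kernel.const_apply]

theorem contDiff_policyOp {n : WithTop ℕ∞} (hn : n ≠ 0) : ContDiff ℝ n (M.policyOp φ) := by
  have h : M.policyOp φ = fun θ => (kernelOp (Kernel.id ×ₖ Kernel.const S M.μ)).comp
    (ContinuousLinearMap.mul ℝ _ (NormedSpace.exp (M.logDensityBM φ θ))) :=
    funext fun θ => M.policyOp_eq φ θ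
  rw [h]
  exact contDiff_const.clm_comp ((ContinuousLinearMap.contDiff _).comp
    (BoundedMeasurable.contDiff_exp.comp (M.contDiff_logDensityBM φ hn)))

/-- The state transition operator of the policy `π_θ`:
`(K f)(s) = ∫∫ f(s') P(ds'|s, a) π_θ(da|s)`. -/
def transitionOp : BoundedMeasurable S →L[ℝ] BoundedMeasurable S :=
  (M.policyOp φ θ).comp (kernelOp M.P)

theorem norm_transitionOp_le : ‖M.transitionOp φ θ‖ ≤ 1 := by
  refine (ContinuousLinearMap.opNorm_comp_le _ _).trans ?_
  exact mul_le_one₀ (norm_kernelOp_le _) (norm_nonneg _) (norm_kernelOp_le _)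

theorem norm_smul_transitionOp_lt_one : ‖M.γ • M.transitionOp φ θ‖ < 1 := by
  rw [norm_smul, Real.norm_of_nonneg M.γ_nonneg]
  exact (mul_le_of_le_one_right M.γ_nonneg (M.norm_transitionOp_le φ θ)).trans_lt M.γ_lt_one

theorem le_transitionOp_pow {C : ℝ} (n : ℕ) {f : BoundedMeasurable S} (h : ∀ s, C ≤ f s) (s : S) :
    C ≤ (M.transitionOp φ θ ^ n) f s := by
  induction n generalizing s with
  | zero => exact h s
  | succ n ih =>
    rw [pow_succ', mul_apply_eq_comp]
    exact le_kernelOp _ (fun x => le_kernelOp _ ih x) s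

theorem smul_transitionOp_pow_apply (n : ℕ) (f : BoundedMeasurable S) :
    ((M.γ • M.transitionOp φ θ) ^ n) f = M.γ ^ n • (M.transitionOp φ θ ^ n) f := by
  induction n with
  | zero => simp
  | succ n ih =>
    rw [pow_succ', mul_apply_eq_comp, ih, pow_succ' (M.transitionOp φ θ), mul_apply_eq_comp,
      map_smul, smul_apply, smul_smul, pow_succ]

/-- The regularized cost `c + τ log dπ_θ/dμ`. -/
def regCost : BoundedMeasurable (S × A) :=
  .mk M.c M.measurable_c 1 M.abs_cost_le_one + M.τ • M.logDensityBM φ θ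

theorem regCost_apply (x : S × A) :
    M.regCost φ θ x = M.c x + M.τ * M.logDensity φ θ x := by
  rw [← logDensityBM_apply]
  rfl

theorem contDiff_regCost {n : WithTop ℕ∞} (hn : n ≠ 0) : ContDiff ℝ n (M.regCost φ) :=
  contDiff_const.add ((M.contDiff_logDensityBM φ hn).const_smul M.τ)

/-- The initial pair `(s_0, a_0)` has law `ρ ⊗ π`. -/
theorem map_zero_trajectoryLaw (ρ : Measure S) (π : Kernel S A) [IsMarkovKernel π] :
    (M.trajectoryLaw ρ π).map (fun ω => ω 0) = ρ ⊗ₘ π := by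
  have h : (M.trajectoryLaw ρ π).map (Preorder.frestrictLe (π := fun _ : ℕ => S × A) 0) =
      (ρ ⊗ₘ π).map (MeasurableEquiv.piUnique fun _ : Finset.Iic 0 => S × A).symm := by
    rw [trajectoryLaw, Kernel.trajMeasure, Measure.map_comp _ _ (by fun_prop),
      Kernel.traj_map_frestrictLe, Kernel.partialTraj_self, Measure.id_comp]
  have h' := congrArg (Measure.map fun y => y ⟨0, Finset.mem_Iic.2 le_rfl⟩) h
  rw [Measure.map_map (measurable_pi_apply _) (by fun_prop),
    Measure.map_map (measurable_pi_apply _) (MeasurableEquiv.measurable _)] at h'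
  refine h'.trans ?_
  convert! Measure.map_id using 2

variable (ρ : Measure S) [IsProbabilityMeasure ρ]

instance isProbabilityMeasure_trajectoryLaw (π : Kernel S A) [IsMarkovKernel π] :
    IsProbabilityMeasure (M.trajectoryLaw ρ π) := by
  unfold trajectoryLaw
  infer_instance

/-- One step of the trajectory, tested against a bounded measurable function. -/
theorem integral_trajectoryLaw_succ (n : ℕ) (f : BoundedMeasurable (S × A)) :
    ∫ ω, f (ω (n + 1)) ∂M.trajectoryLaw ρ (M.policy φ θ) =
      ∫ ω, kernelOp M.P (M.policyOp φ θ f) (ω n) ∂M.trajectoryLaw ρ (M.policy φ θ) := by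
  have hlaw := Kernel.map_frestrictLe_trajMeasure_compProd_eq_map_trajMeasure
    (X := fun _ => S × A) (μ₀ := ρ ⊗ₘ M.policy φ θ) (κ := M.step (M.policy φ θ)) (a := n)
  have h1 : ∫ ω, f (ω (n + 1)) ∂M.trajectoryLaw ρ (M.policy φ θ) =
      ∫ y, f y.2 ∂((M.trajectoryLaw ρ (M.policy φ θ)).map
        (fun x => (Preorder.frestrictLe n x, x (n + 1)))) := by
    rw [integral_map
      (φ := fun x : ℕ → S × A => (Preorder.frestrictLe (π := fun _ : ℕ => S × A) n x, x (n + 1)))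
      (Measurable.aemeasurable (by fun_prop))
      (f := fun y : (Finset.Iic n → S × A) × S × A => f y.2)
      (f.measurable.comp measurable_snd).aestronglyMeasurable]
  rw [h1, trajectoryLaw, ← hlaw, Measure.integral_compProd, integral_map]
  · refine integral_congr_ae (Filter.Eventually.of_forall fun ω => ?_)
    simp only [step, Kernel.comap_apply]
    rw [integral_compProd (f.integrable _), kernelOp_apply]
    refine integral_congr_ae (Filter.Eventually.of_forall fun s => ?_)
    simp only [Kernel.prodMkLeft_apply]
    exact (kernelOp_id_prod_apply _ _ _).symm
  · exact Measurable.aemeasurable (by fun_prop)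
  · exact (kernelOp (M.step (M.policy φ θ) n) f).measurable.aestronglyMeasurable
  · have : IsProbabilityMeasure ((Kernel.trajMeasure (X := fun _ => S × A) (ρ ⊗ₘ M.policy φ θ)
        (M.step (M.policy φ θ))).map (Preorder.frestrictLe n)) :=
      Measure.isProbabilityMeasure_map (Measurable.aemeasurable (by fun_prop))
    refine Integrable.of_bound (f.measurable.comp measurable_snd).aestronglyMeasurable ‖f‖
      (Filter.Eventually.of_forall fun y => f.abs_apply_le_norm y.2)

theorem integral_trajectoryLaw (n : ℕ) (f : BoundedMeasurable (S × A)) :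
    ∫ ω, f (ω n) ∂M.trajectoryLaw ρ (M.policy φ θ) =
      integralCLM ρ ((M.transitionOp φ θ ^ n) (M.policyOp φ θ f)) := by
  induction n generalizing f with
  | zero =>
    have h := congrArg (fun ν => ∫ x, f x ∂ν) (M.map_zero_trajectoryLaw ρ (M.policy φ θ))
    rw [integral_map (measurable_pi_apply 0).aemeasurable f.measurable.aestronglyMeasurable,
      Measure.integral_compProd (f.integrable _)] at h
    rw [h, integralCLM_apply]
    refine integral_congr_ae (Filter.Eventually.of_forall fun s => ?_)
    exact (kernelOp_id_prod_apply _ _ _).symm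
  | succ n ih =>
    rw [integral_trajectoryLaw_succ, ih, pow_succ]
    rfl

theorem value_eq_tsum :
    M.value φ ρ θ = ∑' n : ℕ, M.γ ^ n *
      integralCLM ρ ((M.transitionOp φ θ ^ n) (M.policyOp φ θ (M.regCost φ θ))) := by
  have hs : Summable fun n : ℕ => M.γ ^ n * ‖M.regCost φ θ‖ :=
    (summable_geometric_of_lt_one M.γ_nonneg M.γ_lt_one).mul_right _
  have hm : ∀ n : ℕ, Measurable fun ω : ℕ → S × A => M.γ ^ n * M.regCost φ θ (ω n) := fun n =>
    measurable_const.mul ((M.regCost φ θ).measurable.comp (measurable_pi_apply n))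
  have hb : ∀ (n : ℕ) (ω : ℕ → S × A),
      ‖M.γ ^ n * M.regCost φ θ (ω n)‖ ≤ M.γ ^ n * ‖M.regCost φ θ‖ := fun n ω => by
    rw [norm_mul, Real.norm_of_nonneg (pow_nonneg M.γ_nonneg n)]
    exact mul_le_mul_of_nonneg_left ((M.regCost φ θ).abs_apply_le_norm _)
      (pow_nonneg M.γ_nonneg n)
  have hi : ∀ n : ℕ, Integrable (fun ω : ℕ → S × A => M.γ ^ n * M.regCost φ θ (ω n))
      (M.trajectoryLaw ρ (M.policy φ θ)) := fun n =>
    Integrable.of_bound (hm n).aestronglyMeasurable _ (Filter.Eventually.of_forall (hb n))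
  have hsum : Summable fun n : ℕ => ∫ ω, ‖M.γ ^ n * M.regCost φ θ (ω n)‖
      ∂M.trajectoryLaw ρ (M.policy φ θ) := by
    refine hs.of_nonneg_of_le (fun n => integral_nonneg fun _ => norm_nonneg _) fun n => ?_
    have := integral_mono (hi n).norm (integrable_const _) (hb n)
    simpa using this
  have h := integral_tsum_of_summable_integral_norm hi hsum
  simp only [integral_const_mul, integral_trajectoryLaw] at h
  rw [h, value]
  simp only [regCost_apply]

theorem hasSum_resolvent :
    HasSum (fun n : ℕ => M.γ ^ n *
      integralCLM ρ ((M.transitionOp φ θ ^ n) (M.policyOp φ θ (M.regCost φ θ))))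
      (integralCLM ρ
        (Ring.inverse (1 - M.γ • M.transitionOp φ θ) (M.policyOp φ θ (M.regCost φ θ)))) := by
  have h := (summable_geometric_of_norm_lt_one (M.norm_smul_transitionOp_lt_one φ θ)).hasSum
  rw [geom_series_eq_inverse _ (M.norm_smul_transitionOp_lt_one φ θ)] at h
  have h' := ((integralCLM ρ).comp
    (ContinuousLinearMap.apply ℝ _ (M.policyOp φ θ (M.regCost φ θ)))).hasSum h
  convert! h' using 2 with n
  simp only [ContinuousLinearMap.comp_apply, ContinuousLinearMap.apply_apply,
    smul_transitionOp_pow_apply, map_smul, smul_eq_mul]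

/-- The value is `⟨ρ, (1 - γ K_θ)⁻¹ r_θ⟩`, the Neumann series of the resolvent of the transition
operator applied to the averaged regularized cost. -/
theorem value_eq_resolvent :
    M.value φ ρ θ = integralCLM ρ
      (Ring.inverse (1 - M.γ • M.transitionOp φ θ) (M.policyOp φ θ (M.regCost φ θ))) := by
  rw [value_eq_tsum]
  exact (M.hasSum_resolvent φ θ ρ).tsum_eq

theorem contDiff_value {n : WithTop ℕ∞} (hn : n ≠ 0) : ContDiff ℝ n (M.value φ ρ) := by
  have hK : ContDiff ℝ n (M.transitionOp φ) :=
    (M.contDiff_policyOp φ hn).clm_comp contDiff_const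
  have hR : ContDiff ℝ n fun θ => Ring.inverse (1 - M.γ • M.transitionOp φ θ) := by
    refine contDiff_iff_contDiffAt.2 fun θ => ?_
    have hu : IsUnit (1 - M.γ • M.transitionOp φ θ) :=
      isUnit_one_sub_of_norm_lt_one (M.norm_smul_transitionOp_lt_one φ θ)
    have := contDiffAt_ringInverse ℝ (n := n) hu.unit
    exact ContDiffAt.comp θ this (contDiff_const.sub (hK.const_smul M.γ)).contDiffAt
  have h : M.value φ ρ = fun θ => integralCLM ρ
      (Ring.inverse (1 - M.γ • M.transitionOp φ θ) (M.policyOp φ θ (M.regCost φ θ))) :=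
    funext fun θ => M.value_eq_resolvent φ θ ρ
  rw [h]
  exact (ContinuousLinearMap.contDiff _).comp
    (hR.clm_apply ((M.contDiff_policyOp φ hn).clm_apply (M.contDiff_regCost φ hn)))

end Model

/-! ### Coercivity of the value -/

namespace Model

open Filter Topology

variable {S A : Type*} [MeasurableSpace S] [MeasurableSpace A] [TopologicalSpace A] {p : ℕ}
  (M : Model S A) (φ : Features S A p)

section

variable (θ : EuclideanSpace ℝ (Fin p))

/-- The relative entropy `KL(π_θ(·|s) | μ) = ∫ log (dπ_θ/dμ)(a|s) π_θ(da|s)` as a function of the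
state. -/
def relEntropy : BoundedMeasurable S :=
  M.policyOp φ θ (M.logDensityBM φ θ)

theorem integrable_density (s : S) : Integrable (fun a => M.density φ θ (s, a)) M.μ :=
  (φ.integrable_exp_energy M θ s).div_const (M.partition φ θ s)

theorem integral_density (s : S) : ∫ a, M.density φ θ (s, a) ∂M.μ = 1 := by
  simp only [density]
  rw [integral_div]
  exact div_self (M.partition_pos φ θ s).ne'

theorem relEntropy_apply (s : S) :
    M.relEntropy φ θ s = ∫ a, M.density φ θ (s, a) * M.logDensity φ θ (s, a) ∂M.μ := by
  rw [relEntropy, policyOp_apply_eq_integral_density]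
  simp only [logDensityBM_apply]

/-- The entropy inequality for the indicator of `B`, from Young's inequality
`x h ≤ x log x - x + e^h` with `h = L` on `B` and `h = 0` off `B`. -/
theorem le_relEntropy (s : S) {B : Set A} (hB : MeasurableSet B) (L : ℝ) :
    L * ∫ a in B, M.density φ θ (s, a) ∂M.μ - Real.exp L * M.μ.real B ≤ M.relEntropy φ θ s := by
  have young : ∀ x h : ℝ, 0 < x → x - Real.exp h + x * h ≤ x * Real.log x := fun x h hx => by
    -- `x e^y ≥ x (1 + y)` at `y = h - log x`
    have h1 := Real.add_one_le_exp (h - Real.log x)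
    have h2 : x * Real.exp (h - Real.log x) = Real.exp h := by
      rw [Real.exp_sub, Real.exp_log hx]
      field_simp
    nlinarith [mul_le_mul_of_nonneg_left h1 hx.le]
  have hd := M.integrable_density φ θ s
  have hd₁ : Integrable (fun a => M.density φ θ (s, a) - 1) M.μ := hd.sub (integrable_const 1)
  have hexp : Integrable (B.indicator fun _ => Real.exp L) M.μ :=
    (integrable_const _).indicator hB
  have hd₂ : Integrable
      (fun a => M.density φ θ (s, a) - 1 - B.indicator (fun _ => Real.exp L) a) M.μ :=
    hd₁.sub hexp
  have hdB := (hd.indicator hB).const_mul L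
  have hlog : Integrable (fun a => M.density φ θ (s, a) * M.logDensity φ θ (s, a)) M.μ := by
    refine hd.mul_bdd (c := 2 * ‖θ‖) ?_ (Eventually.of_forall fun a => M.abs_logDensity_le φ θ _)
    exact ((M.measurable_density φ θ).log.comp measurable_prodMk_left).aestronglyMeasurable
  have hle := integral_mono (hd₂.add hdB) hlog fun a => by
    have hx := M.density_pos φ θ (s, a)
    simp only [Pi.add_apply]
    by_cases ha : a ∈ B
    · have := young _ L hx
      simp only [Set.indicator_of_mem ha, logDensity]
      linarith
    · have := young _ 0 hx
      simp only [Set.indicator_of_notMem ha, logDensity]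
      simpa using this
  simp only [Pi.add_apply] at hle
  rw [← relEntropy_apply, integral_add hd₂ hdB, integral_sub hd₁ hexp,
    integral_sub hd (integrable_const 1), integral_density, integral_const_mul,
    integral_indicator hB, integral_indicator hB] at hle
  simp only [integral_const, probReal_univ, smul_eq_mul, MeasurableSet.univ,
    measureReal_restrict_apply, Set.univ_inter, mul_one] at hle
  linarith

theorem relEntropy_nonneg (s : S) : 0 ≤ M.relEntropy φ θ s := by
  simpa using M.le_relEntropy φ θ s MeasurableSet.empty 0

theorem one_sub_le_setIntegral_density (s : S) {B : Set A} (hB : MeasurableSet B) {δ : ℝ}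
    (h : ∀ a ∉ B, M.density φ θ (s, a) ≤ δ) (hδ : 0 ≤ δ) :
    1 - δ ≤ ∫ a in B, M.density φ θ (s, a) ∂M.μ := by
  have hd := M.integrable_density φ θ s
  have h1 := integral_add_compl hB hd
  rw [integral_density] at h1
  have h2 : ∫ a in Bᶜ, M.density φ θ (s, a) ∂M.μ ≤ δ := by
    have := setIntegral_mono_on hd.integrableOn (integrableOn_const (C := δ)) hB.compl h
    refine this.trans ?_
    simp only [integral_const, smul_eq_mul, MeasurableSet.univ, measureReal_restrict_apply,
      Set.univ_inter]
    exact mul_le_of_le_one_left hδ measureReal_le_one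
  linarith

/-- The value dominates the expected relative entropy of the initial action distribution: the
one-step costs are at least `-1`, and every later entropy term is nonnegative. -/
theorem relEntropy_le_value (ρ : Measure S) [IsProbabilityMeasure ρ] :
    M.τ * ∫ s, M.relEntropy φ θ s ∂ρ - (1 - M.γ)⁻¹ ≤ M.value φ ρ θ := by
  have hr : ∀ s, -1 + M.τ * M.relEntropy φ θ s ≤ M.policyOp φ θ (M.regCost φ θ) s := fun s => by
    have h1 : -1 ≤ M.policyOp φ θ (.mk M.c M.measurable_c 1 M.abs_cost_le_one) s :=
      le_kernelOp _ (fun x => neg_le_of_abs_le (M.abs_cost_le_one x)) s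
    rw [regCost, map_add, map_smul, BoundedMeasurable.add_apply, BoundedMeasurable.smul_apply]
    exact add_le_add_left h1 _
  have hr' : ∀ s, -1 ≤ M.policyOp φ θ (M.regCost φ θ) s := fun s => by
    have := mul_nonneg M.τ_pos.le (M.relEntropy_nonneg φ θ s)
    linarith [hr s]
  have hg := (hasSum_geometric_of_lt_one M.γ_nonneg M.γ_lt_one).neg.add
    (hasSum_ite_eq (0 : ℕ) (M.τ * ∫ s, M.relEntropy φ θ s ∂ρ))
  have hv := M.hasSum_resolvent φ θ ρ
  rw [← value_eq_resolvent] at hv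
  have := hasSum_le (fun n => ?_) hg hv
  · linarith
  · rcases eq_or_ne n 0 with rfl | hn
    · have hi := integral_mono (μ := ρ)
        ((integrable_const (-1 : ℝ)).add (((M.relEntropy φ θ).integrable ρ).const_mul M.τ))
        ((M.policyOp φ θ (M.regCost φ θ)).integrable ρ) hr
      simp only [Pi.add_apply] at hi
      rw [integral_add (integrable_const _) (((M.relEntropy φ θ).integrable ρ).const_mul M.τ),
        integral_const_mul] at hi
      simpa [integralCLM_apply] using hi
    · have hi := integral_mono (μ := ρ) (integrable_const (-1 : ℝ))
        (((M.transitionOp φ θ ^ n) (M.policyOp φ θ (M.regCost φ θ))).integrable ρ)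
        (M.le_transitionOp_pow φ θ n hr')
      simp only [integral_const, probReal_univ, smul_eq_mul, one_mul] at hi
      rw [if_neg hn, integralCLM_apply]
      nlinarith [pow_nonneg M.γ_nonneg n]

end

variable [BorelSpace A]

/-- Along parameters going to infinity in the direction `u`, the densities tend to `0` uniformly
off every superlevel set `{a | m - ε ≤ ⟨u, g(s, a)⟩}` below the maximum `m`. -/
theorem eventually_density_le (s : S) (hcont : Continuous fun a => φ.g (s, a))
    {θ : ℕ → EuclideanSpace ℝ (Fin p)} {u : EuclideanSpace ℝ (Fin p)}
    (hθ : Tendsto (fun k => ‖θ k‖) atTop atTop)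
    (hu : Tendsto (fun k => ‖θ k‖⁻¹ • θ k) atTop (𝓝 u)) (a₀ : A) {ε δ : ℝ} (hε : 0 < ε)
    (hδ : 0 < δ) :
    ∀ᶠ k in atTop, ∀ a, inner ℝ u (φ.g (s, a)) < inner ℝ u (φ.g (s, a₀)) - ε →
      M.density φ (θ k) (s, a) ≤ δ := by
  set m := inner ℝ u (φ.g (s, a₀)) with hm
  have hcu : Continuous fun a => (inner ℝ u (φ.g (s, a)) : ℝ) := continuous_const.inner hcont
  -- with `‖u_k - u‖ ≤ ε / 8`, the energies on `U` are at least `‖θ_k‖ (m - 3 ε / 8)` and those off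
  -- the superlevel set at most `‖θ_k‖ (m - 7 ε / 8)`; the gap `ε / 2` gives exponential decay
  let U : Set A := {a | m - ε / 4 < inner ℝ u (φ.g (s, a))}
  have hU : IsOpen U := isOpen_lt continuous_const hcu
  have hUpos : 0 < M.μ.real U := by
    refine ENNReal.toReal_pos (hU.measure_pos M.μ ⟨a₀, ?_⟩).ne' (measure_ne_top _ _)
    change m - ε / 4 < m
    linarith
  have hlim : Tendsto (fun k => Real.exp (-(‖θ k‖ * (ε / 2))) / M.μ.real U) atTop (𝓝 0) := by
    have h1 : Tendsto (fun k => Real.exp (-(‖θ k‖ * (ε / 2)))) atTop (𝓝 0) :=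
      Real.tendsto_exp_neg_atTop_nhds_zero.comp (hθ.atTop_mul_const (by positivity))
    simpa using h1.div_const (M.μ.real U)
  filter_upwards [hlim.eventually_le_const hδ, hθ.eventually_gt_atTop 0,
    Metric.tendsto_nhds.1 hu (ε / 8) (by positivity)] with k hk hpos hdist a ha
  refine le_trans ?_ hk
  have hen : ∀ b, |φ.energy (θ k) (s, b) - ‖θ k‖ * inner ℝ u (φ.g (s, b))| ≤ ‖θ k‖ * (ε / 8) := by
    intro b
    have h1 : θ k = ‖θ k‖ • (‖θ k‖⁻¹ • θ k) := by rw [smul_inv_smul₀ hpos.ne']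
    have h2 : φ.energy (θ k) (s, b) = ‖θ k‖ * inner ℝ (‖θ k‖⁻¹ • θ k) (φ.g (s, b)) := by
      rw [Features.energy, ← real_inner_smul_left, ← h1]
    rw [h2, ← mul_sub, ← inner_sub_left, abs_mul, abs_of_pos hpos]
    refine mul_le_mul_of_nonneg_left ?_ hpos.le
    refine (abs_real_inner_le_norm _ _).trans ?_
    rw [← dist_eq_norm]
    exact (mul_le_of_le_one_right dist_nonneg (φ.norm_le_one _)).trans hdist.le
  have hZ : M.μ.real U * Real.exp (‖θ k‖ * (m - 3 * ε / 8)) ≤ M.partition φ (θ k) s := by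
    have h1 : ∫ b, U.indicator (fun _ => Real.exp (‖θ k‖ * (m - 3 * ε / 8))) b ∂M.μ ≤
        M.partition φ (θ k) s := by
      refine integral_mono ((integrable_const _).indicator hU.measurableSet)
        (φ.integrable_exp_energy M (θ k) s) fun b => ?_
      by_cases hb : b ∈ U
      · rw [Set.indicator_of_mem hb]
        refine Real.exp_le_exp.2 ?_
        have hb' : m - ε / 4 < inner ℝ u (φ.g (s, b)) := hb
        have h3 := (abs_le.1 (hen b)).1
        nlinarith [mul_lt_mul_of_pos_left hb' hpos]
      · rw [Set.indicator_of_notMem hb]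
        positivity
    rw [integral_indicator hU.measurableSet] at h1
    simpa using h1
  have hnum : Real.exp (φ.energy (θ k) (s, a)) ≤ Real.exp (‖θ k‖ * (m - 7 * ε / 8)) := by
    refine Real.exp_le_exp.2 ?_
    have h3 := (abs_le.1 (hen a)).2
    nlinarith [mul_lt_mul_of_pos_left ha hpos]
  calc M.density φ (θ k) (s, a)
      ≤ Real.exp (‖θ k‖ * (m - 7 * ε / 8)) /
          (M.μ.real U * Real.exp (‖θ k‖ * (m - 3 * ε / 8))) := by
        unfold density
        gcongr
    _ = Real.exp (-(‖θ k‖ * (ε / 2))) / M.μ.real U := by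
        have : Real.exp (‖θ k‖ * (m - 7 * ε / 8)) =
            Real.exp (-(‖θ k‖ * (ε / 2))) * Real.exp (‖θ k‖ * (m - 3 * ε / 8)) := by
          rw [← Real.exp_add]
          congr 1
          ring
        rw [this]
        field_simp

/-- Along parameters going to infinity in the direction `u`, the policies concentrate near the
`μ`-null set of maximizers, so their relative entropy with respect to `μ` diverges. -/
theorem tendsto_relEntropy_atTop [CompactSpace A] (s : S) (hcont : Continuous fun a => φ.g (s, a))
    {θ : ℕ → EuclideanSpace ℝ (Fin p)} {u : EuclideanSpace ℝ (Fin p)}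
    (hθ : Tendsto (fun k => ‖θ k‖) atTop atTop)
    (hu : Tendsto (fun k => ‖θ k‖⁻¹ • θ k) atTop (𝓝 u))
    (hnull : M.μ {a | ∀ b, inner ℝ u (φ.g (s, b)) ≤ inner ℝ u (φ.g (s, a))} = 0) :
    Tendsto (fun k => M.relEntropy φ (θ k) s) atTop atTop := by
  have hcu : Continuous fun a => (inner ℝ u (φ.g (s, a)) : ℝ) := continuous_const.inner hcont
  have : Nonempty A := nonempty_of_isProbabilityMeasure M.μ
  obtain ⟨a₀, -, ha₀⟩ := isCompact_univ.exists_isMaxOn Set.univ_nonempty hcu.continuousOn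
  have hmax : ∀ b, inner ℝ u (φ.g (s, b)) ≤ inner ℝ u (φ.g (s, a₀)) := fun b =>
    ha₀ (Set.mem_univ b)
  set m := inner ℝ u (φ.g (s, a₀)) with hm
  let B : ℝ → Set A := fun ε => {a | m - ε ≤ inner ℝ u (φ.g (s, a))}
  have hB : ∀ ε, MeasurableSet (B ε) := fun ε => (isClosed_le continuous_const hcu).measurableSet
  have hBlim : Tendsto (fun n : ℕ => M.μ.real (B (1 / ((n : ℝ) + 1)))) atTop (𝓝 0) := by
    have h1 := tendsto_measure_iInter_atTop (μ := M.μ) (s := fun n : ℕ => B (1 / ((n : ℝ) + 1)))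
      (fun n => (hB _).nullMeasurableSet) (fun i j hij a ha => by
        have h2 := Nat.one_div_le_one_div (α := ℝ) hij
        have h3 : m - 1 / ((j : ℝ) + 1) ≤ inner ℝ u (φ.g (s, a)) := ha
        change m - 1 / ((i : ℝ) + 1) ≤ inner ℝ u (φ.g (s, a))
        linarith) ⟨0, measure_ne_top _ _⟩
    have h2 : M.μ (⋂ n : ℕ, B (1 / ((n : ℝ) + 1))) = 0 := by
      -- the intersection of all superlevel sets is the set of maximizers
      refine measure_mono_null ?_ hnull
      intro a ha b
      refine (hmax b).trans ?_
      have h3 : Tendsto (fun n : ℕ => m - 1 / ((n : ℝ) + 1)) atTop (𝓝 (m - 0)) :=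
        tendsto_const_nhds.sub tendsto_one_div_add_atTop_nhds_zero_nat
      rw [sub_zero] at h3
      exact le_of_tendsto' h3 fun n => Set.mem_iInter.1 ha n
    rw [h2] at h1
    exact (ENNReal.tendsto_toReal ENNReal.zero_ne_top).comp h1
  refine tendsto_atTop.2 fun R => ?_
  -- `L (1 - 1 / L) - 1 = L - 2`, so this `L` makes the entropy inequality give at least `R`
  set L := max R 0 + 2 with hL
  have hLpos : 0 < L := by positivity
  obtain ⟨n, hn⟩ := (hBlim.eventually_le_const (Real.exp_pos (-L))).exists
  filter_upwards [M.eventually_density_le φ s hcont hθ hu a₀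
    (ε := 1 / ((n : ℝ) + 1)) (by positivity) (inv_pos.2 hLpos)] with k hk
  have h1 := M.one_sub_le_setIntegral_density φ (θ k) s (hB (1 / ((n : ℝ) + 1)))
    (fun a ha => hk a (not_le.1 ha)) (inv_pos.2 hLpos).le
  have h2 := M.le_relEntropy φ (θ k) s (hB (1 / ((n : ℝ) + 1))) L
  have h3 : L * (1 - L⁻¹) = L - 1 := by field_simp
  have h4 := mul_le_mul_of_nonneg_left h1 hLpos.le
  have h5 : Real.exp L * M.μ.real (B (1 / ((n : ℝ) + 1))) ≤ 1 := by
    have := mul_le_mul_of_nonneg_left hn (Real.exp_pos L).le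
    rwa [← Real.exp_add, add_neg_cancel, Real.exp_zero] at this
  have h6 : R ≤ max R 0 := le_max_left _ _
  linarith

/-- Fatou's lemma turns the pointwise divergence of the relative entropy into boundedness of the
sublevel sets of the value. -/
theorem exists_norm_le_of_value_le [CompactSpace A] (ρ : Measure S) [IsProbabilityMeasure ρ]
    (hmax : M.MaxSetNull φ) (C : ℝ) :
    ∃ R : ℝ, ∀ θ : EuclideanSpace ℝ (Fin p), M.value φ ρ θ ≤ C → ‖θ‖ ≤ R := by
  by_contra! hcon
  choose θ hθC hθ using fun k : ℕ => hcon (k : ℝ)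
  have hnorm : Tendsto (fun k => ‖θ k‖) atTop atTop :=
    tendsto_atTop_mono (fun k => (hθ k).le) tendsto_natCast_atTop_atTop
  have hsphere : ∀ k, ‖θ k‖⁻¹ • θ k ∈ Metric.sphere (0 : EuclideanSpace ℝ (Fin p)) 1 := fun k => by
    have hpos : 0 < ‖θ k‖ := (Nat.cast_nonneg k).trans_lt (hθ k)
    rw [mem_sphere_zero_iff_norm, norm_smul, norm_inv, norm_norm, inv_mul_cancel₀ hpos.ne']
  obtain ⟨u, hu, ψ, hψ, hlim⟩ := (isCompact_sphere _ _).tendsto_subseq hsphere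
  rw [mem_sphere_zero_iff_norm] at hu
  have hpt : ∀ s, Tendsto (fun k => ENNReal.ofReal (M.relEntropy φ (θ (ψ k)) s)) atTop (𝓝 ∞) :=
    fun s => ENNReal.tendsto_ofReal_atTop.comp
      (M.tendsto_relEntropy_atTop φ s (hmax s).1 (hnorm.comp hψ.tendsto_atTop) hlim
        ((hmax s).2 u hu))
  have hfatou := lintegral_liminf_le (μ := ρ) (u := (atTop : Filter ℕ))
    (f := fun k s => ENNReal.ofReal (M.relEntropy φ (θ (ψ k)) s))
    fun k => (M.relEntropy φ (θ (ψ k))).measurable.ennreal_ofReal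
  simp only [(hpt _).liminf_eq, lintegral_const, measure_univ, mul_one, top_le_iff] at hfatou
  have hbound : ∀ k, ∫⁻ s, ENNReal.ofReal (M.relEntropy φ (θ (ψ k)) s) ∂ρ ≤
      ENNReal.ofReal ((C + (1 - M.γ)⁻¹) / M.τ) := fun k => by
    rw [← ofReal_integral_eq_lintegral_ofReal ((M.relEntropy φ (θ (ψ k))).integrable ρ)
      (Eventually.of_forall (M.relEntropy_nonneg φ (θ (ψ k))))]
    refine ENNReal.ofReal_le_ofReal ?_
    rw [le_div_iff₀ M.τ_pos]
    have := M.relEntropy_le_value φ (θ (ψ k)) ρ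
    linarith [hθC (ψ k)]
  have hle : liminf (fun k => ∫⁻ s, ENNReal.ofReal (M.relEntropy φ (θ (ψ k)) s) ∂ρ) atTop ≤
      ENNReal.ofReal ((C + (1 - M.γ)⁻¹) / M.τ) :=
    (liminf_le_liminf (Eventually.of_forall hbound)).trans_eq (liminf_const _)
  rw [hfatou, top_le_iff] at hle
  exact ENNReal.ofReal_ne_top hle

end Model

/-! ### Gradient flows of coercive functions -/

section Flow

open Set

/-- A bounded Lipschitz vector field has an integral curve on `[0, ∞)`. -/
theorem exists_forall_hasDerivWithinAt_Ici {E : Type*} [NormedAddCommGroup E] [NormedSpace ℝ E]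
    [CompleteSpace E] {f : E → E} {K L : NNReal} (hK : LipschitzWith K f) (hL : ∀ x, ‖f x‖ ≤ L)
    (x₀ : E) :
    ∃ θ : ℝ → E, θ 0 = x₀ ∧ ∀ t, 0 ≤ t → HasDerivWithinAt θ (f (θ t)) (Ici 0) t := by
  have hloc : ∀ n : ℕ, ∃ α : ℝ → E, α 0 = x₀ ∧
      ∀ t ∈ Icc (0 : ℝ) n, HasDerivWithinAt α (f (α t)) (Icc 0 n) t := fun n => by
    have h : IsPicardLindelof (fun _ => f) (tmin := 0) (tmax := n)
        ⟨0, left_mem_Icc.2 (Nat.cast_nonneg n)⟩ x₀ (L * n) 0 L K :=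
      -- a curve of speed at most `L` stays within distance `L n` up to time `n`
      IsPicardLindelof.of_time_independent (fun x _ => hL x) hK.lipschitzOnWith (by simp)
    exact h.exists_eq_forall_mem_Icc_hasDerivWithinAt₀
  choose α hα₀ hα using hloc
  have huniq : ∀ m n : ℕ, m ≤ n → EqOn (α m) (α n) (Icc 0 m) := fun m n hmn => by
    have hsub : Icc (0 : ℝ) m ⊆ Icc 0 n := Icc_subset_Icc_right (by exact_mod_cast hmn)
    have hright : ∀ k : ℕ, m ≤ k → ∀ t ∈ Ico (0 : ℝ) m,
        HasDerivWithinAt (α k) (f (α k t)) (Ici t) t := fun k hk t ht => by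
      have htk : t < k := ht.2.trans_le (by exact_mod_cast hk)
      refine (hα k t ⟨ht.1, htk.le⟩).mono_of_mem_nhdsWithin ?_
      exact Filter.mem_of_superset (Icc_mem_nhdsGE htk) (Icc_subset_Icc_left ht.1)
    exact ODE_solution_unique_of_mem_Icc_right (v := fun _ => f) (s := fun _ => univ)
      (fun _ _ => hK.lipschitzOnWith) (fun t ht => (hα m t ht).continuousWithinAt)
      (hright m le_rfl) (fun _ _ => mem_univ _)
      (fun t ht => ((hα n t (hsub ht)).mono hsub).continuousWithinAt)
      (hright n hmn) (fun _ _ => mem_univ _) (by rw [hα₀, hα₀])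
  have hagree : ∀ (n : ℕ) (t : ℝ), t ∈ Icc (0 : ℝ) n → α ⌈t⌉₊ t = α n t := fun n t ht =>
    huniq _ _ (Nat.ceil_le.2 ht.2) ⟨ht.1, Nat.le_ceil t⟩
  -- near `t` the glued curve agrees with the solution on `[0, ⌈t⌉₊ + 1]`, which has `t` in its
  -- interior relative to `[0, ∞)`
  refine ⟨fun t => α ⌈t⌉₊ t, by simpa using hα₀ 0, fun t ht => ?_⟩
  have htn : t < (⌈t⌉₊ + 1 : ℕ) := (Nat.le_ceil t).trans_lt (by simp)
  have hmem : t ∈ Icc (0 : ℝ) (⌈t⌉₊ + 1 : ℕ) := ⟨ht, htn.le⟩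
  have h := (hα (⌈t⌉₊ + 1) t hmem).congr (fun s hs => hagree _ s hs) (hagree _ t hmem)
  rw [← hagree _ t hmem] at h
  refine h.mono_of_mem_nhdsWithin ?_
  rw [← Ici_inter_Iic]
  exact inter_mem_nhdsWithin _ (Iic_mem_nhds htn)

/-- A `C²` function whose sublevel set at `θ₀` is bounded has a gradient flow from `θ₀`, and the
flow stays in that sublevel set. The gradient is cut off outside a ball containing the sublevel
set; the cut-off flow still decreases `F`, hence never leaves the region where it is the gradient
flow. -/
theorem exists_isGradientFlow {p : ℕ} {F : EuclideanSpace ℝ (Fin p) → ℝ} (hF : ContDiff ℝ 2 F)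
    (θ₀ : EuclideanSpace ℝ (Fin p)) {R : ℝ} (hR : ∀ θ, F θ ≤ F θ₀ → ‖θ‖ ≤ R) :
    ∃ θ : ℝ → EuclideanSpace ℝ (Fin p), IsGradientFlow F θ₀ θ ∧ ∀ t, 0 ≤ t → ‖θ t‖ ≤ R := by
  have hgrad : ContDiff ℝ 1 (gradient F) :=
    (InnerProductSpace.toDual ℝ (EuclideanSpace ℝ (Fin p))).symm.contDiff.comp
      (hF.fderiv_right (by norm_num))
  have hR0 : 0 ≤ R := (norm_nonneg _).trans (hR θ₀ le_rfl)
  let χ : ContDiffBump (0 : EuclideanSpace ℝ (Fin p)) := ⟨R + 1, R + 2, by linarith, by linarith⟩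
  let f : EuclideanSpace ℝ (Fin p) → EuclideanSpace ℝ (Fin p) := fun θ => χ θ • -gradient F θ
  have hf : ContDiff ℝ 1 f := χ.contDiff.smul hgrad.neg
  have hsupp : HasCompactSupport f := χ.hasCompactSupport.smul_right
  obtain ⟨K, hK⟩ := ContDiff.lipschitzWith_of_hasCompactSupport hsupp hf one_ne_zero
  obtain ⟨L, hL⟩ := hsupp.exists_bound_of_continuous hf.continuous
  obtain ⟨θ, hθ₀, hθ⟩ := exists_forall_hasDerivWithinAt_Ici hK (L := L.toNNReal)
    (fun x => (hL x).trans (Real.le_coe_toNNReal L)) θ₀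
  have hFgrad : ∀ x, HasGradientAt F (gradient F x) x := fun x =>
    (hF.differentiable (by norm_num) x).hasGradientAt
  have hderiv : ∀ t, 0 ≤ t → HasDerivWithinAt (fun t => F (θ t))
      (-(χ (θ t) * ‖gradient F (θ t)‖ ^ 2)) (Ici 0) t := fun t ht => by
    have h := (hFgrad (θ t)).hasFDerivAt.comp_hasDerivWithinAt t (hθ t ht)
    convert! h using 1
    rw [InnerProductSpace.toDual_apply_apply]
    simp only [f]
    rw [real_inner_smul_right, inner_neg_right, real_inner_self_eq_norm_sq, mul_neg]
  have hanti : AntitoneOn (fun t => F (θ t)) (Ici 0) := by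
    refine antitoneOn_of_hasDerivWithinAt_nonpos (convex_Ici 0)
      (fun t ht => (hderiv t ht).continuousWithinAt)
      (fun t ht => (hderiv t (interior_subset ht)).mono interior_subset) fun t _ => ?_
    exact neg_nonpos.2 (mul_nonneg χ.nonneg (sq_nonneg _))
  have hbd : ∀ t, 0 ≤ t → ‖θ t‖ ≤ R := fun t ht => by
    refine hR _ ?_
    have := hanti (mem_Ici.2 le_rfl) (mem_Ici.2 ht) ht
    simpa only [hθ₀] using this
  refine ⟨θ, ⟨hθ₀, fun t ht => ⟨gradient F (θ t), hFgrad _, ?_⟩⟩, hbd⟩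
  have hχ : χ (θ t) = 1 := by
    refine χ.one_of_mem_closedBall ?_
    rw [mem_closedBall_zero_iff]
    exact (hbd t ht).trans (by simp [χ])
  have := hθ t ht
  simpa only [f, hχ, one_smul] using this

end Flow

end EntropyMDP

end

theorem mainTheorem6
    {S A : Type*}
    [TopologicalSpace S] [PolishSpace S] [MeasurableSpace S] [BorelSpace S]
    [TopologicalSpace A] [PolishSpace A] [CompactSpace A] [MeasurableSpace A] [BorelSpace A]
    {p : ℕ} (M : EntropyMDP.Model S A) (φ : EntropyMDP.Features S A p)
    (ρ : Measure S) [IsProbabilityMeasure ρ]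
    (hmax : M.MaxSetNull φ) (θ₀ : EuclideanSpace ℝ (Fin p)) :
    ∃ θ : ℝ → EuclideanSpace ℝ (Fin p),
      EntropyMDP.IsGradientFlow (M.value φ ρ) θ₀ θ ∧
        (⨆ t : Set.Ici (0 : ℝ), EntropyMDP.supNorm (M.logDensity φ (θ t))) < ∞ := by
  obtain ⟨R, hR⟩ := M.exists_norm_le_of_value_le φ ρ hmax (M.value φ ρ θ₀)
  obtain ⟨θ, hθ, hbd⟩ := EntropyMDP.exists_isGradientFlow
    (M.contDiff_value φ ρ two_ne_zero) θ₀ hR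
  refine ⟨θ, hθ, lt_of_le_of_lt (iSup_le fun t => iSup_le fun x => ?_)
    (ENNReal.ofReal_lt_top (r := 2 * R))⟩
  rw [← ofReal_norm]
  refine ENNReal.ofReal_le_ofReal ((M.abs_logDensity_le φ (θ t) x).trans ?_)
  linarith [hbd t t.2]
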